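/- Let $A, B$ be positive definite complex $n \times n$ matrices, let $m \ge 1$ be an integer, and for a real number $\nu$ put $r = \min\{\nu, 1-\nu\}$ and $r_0 = \min\{2r, 1-2r\}$. Write $|X| = (X^*X)^{1/2}$ for a complex matrix $X$. If $0 < \nu \le \frac12$, then $$\left(\operatorname{tr}|A^{1-\nu}B^{\nu}|\right)^m + \nu^m\left(\operatorname{tr}A+\operatorname{tr}B\right)^m - \left(2\nu(\operatorname{tr}A\,\operatorname{tr}B)^{\frac12} - r_0\left((\operatorname{tr}A\,\operatorname{tr}B)^{\frac14} - (\operatorname{tr}A)^{\frac12}\right)^2\right)^m \le \left(\operatorname{tr}((1-\nu)A+\nu B)\right)^m.$$ If $\frac12 \le \nu \le 1$, then $$\left(\operatorname{tr}|A^{1-\nu}B^{\nu}|\right)^m + (1-\nu)^m\left(\operatorname{tr}A+\operatorname{tr}B\right)^m - \left(2(1-\nu)(\operatorname{tr}A\,\operatorname{tr}B)^{\frac12} - r_0\left((\operatorname{tr}A\,\operatorname{tr}B)^{\frac14} - (\operatorname{tr}B)^{\frac12}\right)^2\right)^m \le \left(\operatorname{tr}((1-\nu)A+\nu B)\right)^m.$$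 -/

import Mathlib

open scoped MatrixOrder ComplexOrder

/-- The (real) trace of a complex matrix; it is only applied to Hermitian matrices,
whose trace is real. -/
noncomputable def trR {n : ℕ} (M : Matrix (Fin n) (Fin n) ℂ) : ℝ := M.trace.re

/-- `r₀ = min {2r, 1 - 2r}` with `r = min {ν, 1 - ν}`. -/
noncomputable def rZero (ν : ℝ) : ℝ := min (2 * min ν (1 - ν)) (1 - 2 * min ν (1 - ν))

/-! Put a = tr A and b = tr B. Hölder's inequality for traces, `trR_abs_rpow_mul_rpow_le`, bounds
the trace norm by a^(1-ν) b^ν, so only the scalar inequality `pow_refined_young` in a and b is left.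
Its case m = 1 is weighted AM-GM after cancellation. Higher m follow by a convexity-type argument:
in x + y ≤ w + z the term w dominates x and y, so the powers obey the same inequality. -/

/-- A power version of `x + y ≤ w + z`, where the real number `z` may be negative. -/
theorem pow_add_pow_sub_pow_le {x y z w : ℝ} (hx : 0 ≤ x) (hy : 0 ≤ y) (hxw : x ≤ w)
    (hyw : y ≤ w) (hzy : z ≤ y) (h : x + y - z ≤ w) {m : ℕ} (hm : m ≠ 0) :
    x ^ m + y ^ m - z ^ m ≤ w ^ m := by
  rcases le_or_gt 0 z with hz | hz
  · rcases le_total z x with hzx | hzx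
    -- This is x^m - z^m ≤ w^m - y^m, factored and compared factor by factor.
    · have hsum : (∑ i ∈ Finset.range m, x ^ i * z ^ (m - 1 - i)) * (x - z) ≤
          (∑ i ∈ Finset.range m, w ^ i * y ^ (m - 1 - i)) * (w - y) := by
        have hw : 0 ≤ w := hx.trans hxw
        refine mul_le_mul (Finset.sum_le_sum fun i _ => ?_) (by linarith) (by linarith)
          (Finset.sum_nonneg fun i _ => by positivity)
        gcongr
      rw [(Commute.all x z).geom_sum₂_mul, (Commute.all w y).geom_sum₂_mul] at hsum
      linarith
    · have hxz : x ^ m ≤ z ^ m := pow_le_pow_left₀ hx hzx m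
      have hyw' : y ^ m ≤ w ^ m := pow_le_pow_left₀ hy hyw m
      linarith
  · have hs : 0 ≤ -z := by linarith
    have hsum₁ := pow_add_pow_le (add_nonneg hx hy) hs hm
    have hsum₂ := pow_add_pow_le hx hy hm
    have hpow : (x + y + -z) ^ m ≤ w ^ m := pow_le_pow_left₀ (by positivity) (by linarith) m
    have hneg : -z ^ m ≤ (-z) ^ m := by
      rcases Nat.even_or_odd m with he | ho
      · rw [he.neg_pow]
        have := he.pow_nonneg z
        linarith
      · rw [ho.neg_pow]
    linarith

/-- The twice refined Young inequality, in terms of fourth roots. -/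
theorem rpow_mul_rpow_add_refinement_le {p q ν : ℝ} (hp : 0 < p) (hq : 0 < q) (hν : 0 ≤ ν)
    (hν' : ν ≤ 1 / 2) :
    (p ^ 4) ^ (1 - ν) * (q ^ 4) ^ ν + ν * (p ^ 4 + q ^ 4) -
        (2 * ν * (p * q) ^ 2 - min (2 * ν) (1 - 2 * ν) * (p * q - p ^ 2) ^ 2) ≤
      (1 - ν) * p ^ 4 + ν * q ^ 4 := by
  have hlp : ∀ k : ℕ, p ^ k = Real.exp (k * Real.log p) := fun k => by
    rw [Real.exp_nat_mul, Real.exp_log hp]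
  have hlq : ∀ k : ℕ, q ^ k = Real.exp (k * Real.log q) := fun k => by
    rw [Real.exp_nat_mul, Real.exp_log hq]
  rcases le_total (2 * ν) (1 - 2 * ν) with h | h
  · rw [min_eq_left h]
    -- With the minimum equal to 2ν, moving everything but the geometric mean to the right leaves (1
    -- - 4ν)p⁴ + 4νp³q.
    have key := Real.geom_mean_le_arith_mean2_weighted (w₁ := 1 - 4 * ν) (w₂ := 4 * ν)
      (p₁ := p ^ 4) (p₂ := p ^ 3 * q ^ 1) (by linarith) (by linarith) (by positivity)
      (by positivity) (by ring)
    have heq : (p ^ 4) ^ (1 - 4 * ν) * (p ^ 3 * q ^ 1) ^ (4 * ν) =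
        (p ^ 4) ^ (1 - ν) * (q ^ 4) ^ ν := by
      simp only [hlp, hlq, ← Real.exp_add, ← Real.exp_mul]
      congr 1
      push_cast
      ring
    rw [heq] at key
    linarith
  · rw [min_eq_right h]
    -- Here the same cancellation leaves (4ν - 1)p²q² + (2 - 4ν)p³q.
    have key := Real.geom_mean_le_arith_mean2_weighted (w₁ := 4 * ν - 1) (w₂ := 2 - 4 * ν)
      (p₁ := p ^ 2 * q ^ 2) (p₂ := p ^ 3 * q ^ 1) (by linarith) (by linarith) (by positivity)
      (by positivity) (by ring)
    have heq : (p ^ 2 * q ^ 2) ^ (4 * ν - 1) * (p ^ 3 * q ^ 1) ^ (2 - 4 * ν) =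
        (p ^ 4) ^ (1 - ν) * (q ^ 4) ^ ν := by
      simp only [hlp, hlq, ← Real.exp_add, ← Real.exp_mul]
      congr 1
      push_cast
      ring
    rw [heq] at key
    linarith

/-- The `m`-th power form of the refined Young inequality. -/
theorem pow_refined_young {a b ν t : ℝ} (ha : 0 < a) (hb : 0 < b) (hν : 0 ≤ ν)
    (hν' : ν ≤ 1 / 2) (ht : 0 ≤ t) (hta : t ≤ a ^ (1 - ν) * b ^ ν) {m : ℕ} (hm : m ≠ 0) :
    t ^ m + ν ^ m * (a + b) ^ m - (2 * ν * (a * b) ^ (1 / 2 : ℝ) -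
        rZero ν * ((a * b) ^ (1 / 4 : ℝ) - a ^ (1 / 2 : ℝ)) ^ 2) ^ m ≤
      ((1 - ν) * a + ν * b) ^ m := by
  obtain ⟨p, hp, rfl⟩ : ∃ p : ℝ, 0 < p ∧ p ^ 4 = a :=
    ⟨a ^ (1 / 4 : ℝ), by positivity, by rw [← Real.rpow_mul_natCast ha.le]; norm_num⟩
  obtain ⟨q, hq, rfl⟩ : ∃ q : ℝ, 0 < q ∧ q ^ 4 = b :=
    ⟨b ^ (1 / 4 : ℝ), by positivity, by rw [← Real.rpow_mul_natCast hb.le]; norm_num⟩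
  have hhalf : ∀ x : ℝ, 0 < x → (x ^ 4) ^ (1 / 2 : ℝ) = x ^ 2 := fun x hx => by
    rw [← Real.rpow_natCast_mul hx.le, ← Real.rpow_natCast]; norm_num
  have hquarter : ∀ x : ℝ, 0 < x → (x ^ 4) ^ (1 / 4 : ℝ) = x := fun x hx => by
    rw [← Real.rpow_natCast_mul hx.le]; norm_num
  have hr : rZero ν = min (2 * ν) (1 - 2 * ν) := by
    rw [rZero, min_eq_left (by linarith : ν ≤ 1 - ν)]
  have hpq : 0 < p * q := by positivity
  rw [← mul_pow p q, hhalf _ hpq, hquarter _ hpq, hhalf p hp, hr, ← mul_pow]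
  have hmin : 0 ≤ min (2 * ν) (1 - 2 * ν) := le_min (by linarith) (by linarith)
  have hyoung := Real.geom_mean_le_arith_mean2_weighted (w₁ := 1 - ν) (w₂ := ν)
    (p₁ := p ^ 4) (p₂ := q ^ 4) (by linarith) hν (by positivity) (by positivity) (by ring)
  have hrefined := rpow_mul_rpow_add_refinement_le hp hq hν hν'
  refine pow_add_pow_sub_pow_le ht (by positivity) (hta.trans hyoung) ?_ ?_ (by linarith) hm
  · nlinarith [pow_pos hp 4]
  · have h₁ : 0 ≤ min (2 * ν) (1 - 2 * ν) * (p * q - p ^ 2) ^ 2 := by positivity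
    have h₂ : 0 ≤ ν * (p ^ 2 - q ^ 2) ^ 2 := by positivity
    linarith

section

open Matrix

/-- An invertible matrix is a unitary multiple of its modulus. -/
theorem exists_unitary_mul_eq_abs {n : ℕ} {X : Matrix (Fin n) (Fin n) ℂ} (hX : IsUnit X) :
    ∃ U ∈ unitaryGroup (Fin n) ℂ, U * X = CFC.abs X := by
  set P := CFC.abs X with hP
  have hPP : P * P = star X * X := CFC.abs_mul_abs X
  have hPs : star P = P := (CFC.abs_nonneg X).isSelfAdjoint
  have hPu : IsUnit P := by
    have h : IsUnit (P * P) := by rw [hPP]; exact hX.star.mul hX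
    rw [Matrix.isUnit_iff_isUnit_det] at h ⊢
    rw [det_mul] at h
    exact isUnit_of_mul_isUnit_left h
  have hdet := (Matrix.isUnit_iff_isUnit_det _).1 hPu
  have hPi : star P⁻¹ = P⁻¹ := by
    rw [star_eq_conjTranspose, conjTranspose_nonsing_inv, ← star_eq_conjTranspose, hPs]
  refine ⟨P⁻¹ * star X, ?_, ?_⟩
  · rw [mem_unitaryGroup_iff, star_mul, star_star, hPi, mul_assoc, ← mul_assoc (star X), ← hPP,
      mul_assoc, mul_nonsing_inv _ hdet, mul_one, nonsing_inv_mul _ hdet]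
  · rw [mul_assoc, ← hPP, nonsing_inv_mul_cancel_left _ _ hdet]

theorem rpow_eq_spectral {n : ℕ} {A : Matrix (Fin n) (Fin n) ℂ} (hA : A.PosSemidef) (s : ℝ) :
    A ^ s = hA.1.eigenvectorUnitary * diagonal (fun i => ((hA.1.eigenvalues i ^ s : ℝ) : ℂ)) *
      star (hA.1.eigenvectorUnitary : Matrix (Fin n) (Fin n) ℂ) := by
  rw [CFC.rpow_eq_cfc_real hA.nonneg, hA.1.cfc_eq]
  rfl

theorem trR_eq_sum_eigenvalues {n : ℕ} {A : Matrix (Fin n) (Fin n) ℂ} (hA : A.IsHermitian) :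
    trR A = ∑ i, hA.eigenvalues i := by
  rw [trR, hA.trace_eq_sum_eigenvalues]
  simp

theorem sum_norm_sq_row {n : ℕ} {U : Matrix (Fin n) (Fin n) ℂ} (hU : U ∈ unitaryGroup (Fin n) ℂ)
    (i : Fin n) : ∑ j, ‖U i j‖ ^ 2 = 1 := by
  have h := congrFun (congrFun (mem_unitaryGroup_iff.1 hU) i) i
  rw [mul_apply] at h
  simp only [star_apply, one_apply_eq, RCLike.star_def, Complex.mul_conj'] at h
  exact_mod_cast h

theorem sum_norm_sq_col {n : ℕ} {U : Matrix (Fin n) (Fin n) ℂ} (hU : U ∈ unitaryGroup (Fin n) ℂ)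
    (j : Fin n) : ∑ i, ‖U i j‖ ^ 2 = 1 := by
  simpa using sum_norm_sq_row (Unitary.star_mem hU) j

/-- Hölder's inequality with doubly stochastic weights. -/
theorem sum_mul_rpow_mul_rpow_le {ι κ : Type*} [Fintype ι] [Fintype κ] {S : ι → κ → ℝ}
    {α : ι → ℝ} {β : κ → ℝ} {ν : ℝ}
    (hS : ∀ i j, 0 ≤ S i j) (hrow : ∀ i, ∑ j, S i j = 1) (hcol : ∀ j, ∑ i, S i j = 1)
    (hα : ∀ i, 0 ≤ α i) (hβ : ∀ j, 0 ≤ β j) (ha : 0 < ∑ i, α i) (hb : 0 < ∑ j, β j)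
    (hν : 0 ≤ ν) (hν' : ν ≤ 1) :
    ∑ i, ∑ j, S i j * (α i ^ (1 - ν) * β j ^ ν) ≤ (∑ i, α i) ^ (1 - ν) * (∑ j, β j) ^ ν := by
  set a := ∑ i, α i with hadef
  set b := ∑ j, β j with hbdef
  have hc : 0 < a ^ (1 - ν) * b ^ ν := by positivity
  have hterm : ∀ i j, S i j * (α i ^ (1 - ν) * β j ^ ν) ≤
      a ^ (1 - ν) * b ^ ν * ((1 - ν) / a * (S i j * α i) + ν / b * (S i j * β j)) := by
    intro i j
    -- After normalizing by the sums, the weighted arithmetic means add up to (1 - ν) + ν = 1.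
    have h := Real.geom_mean_le_arith_mean2_weighted (w₁ := 1 - ν) (w₂ := ν) (p₁ := α i / a)
      (p₂ := β j / b) (by linarith) hν (div_nonneg (hα i) ha.le) (div_nonneg (hβ j) hb.le)
      (by ring)
    rw [Real.div_rpow (hα i) ha.le, Real.div_rpow (hβ j) hb.le, div_mul_div_comm,
      div_le_iff₀ hc] at h
    calc _ ≤ S i j * (((1 - ν) * (α i / a) + ν * (β j / b)) * (a ^ (1 - ν) * b ^ ν)) :=
          mul_le_mul_of_nonneg_left h (hS i j)
      _ = _ := by ring
  refine (Finset.sum_le_sum fun i _ => Finset.sum_le_sum fun j _ => hterm i j).trans_eq ?_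
  have hSα : ∑ i, ∑ j, S i j * α i = a := by simp [← Finset.sum_mul, hrow, hadef]
  have hSβ : ∑ i, ∑ j, S i j * β j = b := by
    rw [Finset.sum_comm]
    simp [← Finset.sum_mul, hcol, hbdef]
  simp only [← Finset.mul_sum, Finset.sum_add_distrib]
  rw [hSα, hSβ, div_mul_cancel₀ _ ha.ne', div_mul_cancel₀ _ hb.ne']
  ring

/-- Hölder's inequality for the pairing of a unitary matrix with `A ^ (1 - ν) * B ^ ν`. -/
theorem trR_unitary_mul_rpow_mul_rpow_le {n : ℕ} {A B U : Matrix (Fin n) (Fin n) ℂ}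
    (hA : A.PosSemidef) (hB : B.PosSemidef) (hU : U ∈ unitaryGroup (Fin n) ℂ)
    (ha : 0 < trR A) (hb : 0 < trR B) {ν : ℝ} (hν : 0 ≤ ν) (hν' : ν ≤ 1) :
    trR (U * (A ^ (1 - ν) * B ^ ν)) ≤ trR A ^ (1 - ν) * trR B ^ ν := by
  rw [trR_eq_sum_eigenvalues hA.1] at ha ⊢
  rw [trR_eq_sum_eigenvalues hB.1] at hb ⊢
  rw [rpow_eq_spectral hA, rpow_eq_spectral hB]
  set α := hA.1.eigenvalues
  set β := hB.1.eigenvalues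
  have hα : ∀ i, 0 ≤ α i := hA.eigenvalues_nonneg
  have hβ : ∀ i, 0 ≤ β i := hB.eigenvalues_nonneg
  obtain ⟨V, hV⟩ := hA.1.eigenvectorUnitary
  obtain ⟨W, hW⟩ := hB.1.eigenvectorUnitary
  dsimp only
  set P := star W * U * V with hPdef
  set Q := star V * W with hQdef
  have hP : P ∈ unitaryGroup (Fin n) ℂ := mul_mem (mul_mem (Unitary.star_mem hW) hU) hV
  have hQ : Q ∈ unitaryGroup (Fin n) ℂ := mul_mem (Unitary.star_mem hV) hW
  set D := diagonal (fun i => ((α i ^ (1 - ν) : ℝ) : ℂ)) with hD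
  set E := diagonal (fun i => ((β i ^ ν : ℝ) : ℂ)) with hE
  have htr : (U * (V * D * star V * (W * E * star W))).trace =
      ∑ i, ∑ j, (α i ^ (1 - ν) * β j ^ ν : ℝ) * (P j i * Q i j) := by
    have hcycle : (U * (V * D * star V * (W * E * star W))).trace = (P * D * (Q * E)).trace := by
      rw [show U * (V * D * star V * (W * E * star W)) = U * V * D * Q * E * star W by
        simp only [hQdef, mul_assoc], trace_mul_comm]
      simp only [hPdef, mul_assoc]
    rw [hcycle, trace, Finset.sum_comm]
    refine Finset.sum_congr rfl fun j _ => ?_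
    rw [diag_apply, mul_apply]
    refine Finset.sum_congr rfl fun i _ => ?_
    rw [hD, hE, mul_diagonal, mul_diagonal]
    push_cast
    ring
  rw [trR, htr, Complex.re_sum]
  simp only [Complex.re_sum, Complex.re_ofReal_mul]
  -- These weights dominate Re(P j i * Q i j) by AM-GM, and are doubly stochastic because P and Q
  -- are unitary.
  refine le_trans ?_ (sum_mul_rpow_mul_rpow_le (S := fun i j => (‖P j i‖ ^ 2 + ‖Q i j‖ ^ 2) / 2)
    (fun i j => by positivity) (fun i => ?_) (fun j => ?_) hα hβ ha hb hν hν')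
  · refine Finset.sum_le_sum fun i _ => Finset.sum_le_sum fun j _ => ?_
    rw [mul_comm]
    refine mul_le_mul_of_nonneg_right ?_
      (mul_nonneg (Real.rpow_nonneg (hα i) _) (Real.rpow_nonneg (hβ j) _))
    refine (Complex.re_le_norm _).trans ?_
    rw [norm_mul]
    linarith [two_mul_le_add_sq ‖P j i‖ ‖Q i j‖]
  · rw [← Finset.sum_div, Finset.sum_add_distrib, sum_norm_sq_col hP, sum_norm_sq_row hQ]
    norm_num
  · rw [← Finset.sum_div, Finset.sum_add_distrib, sum_norm_sq_row hP, sum_norm_sq_col hQ]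
    norm_num

/-- Hölder's inequality for the trace norm of `A ^ (1 - ν) * B ^ ν`. -/
theorem trR_abs_rpow_mul_rpow_le {n : ℕ} {A B : Matrix (Fin n) (Fin n) ℂ} (hA : A.PosDef)
    (hB : B.PosDef) (ha : 0 < trR A) (hb : 0 < trR B) {ν : ℝ} (hν : 0 ≤ ν) (hν' : ν ≤ 1) :
    trR (CFC.abs (A ^ (1 - ν) * B ^ ν)) ≤ trR A ^ (1 - ν) * trR B ^ ν := by
  have hX : IsUnit (A ^ (1 - ν) * B ^ ν) :=
    (hA.isUnit.cfcRpow _ hA.posSemidef.nonneg).mul (hB.isUnit.cfcRpow _ hB.posSemidef.nonneg)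
  obtain ⟨U, hU, hUX⟩ := exists_unitary_mul_eq_abs hX
  rw [← hUX]
  exact trR_unitary_mul_rpow_mul_rpow_le hA.posSemidef hB.posSemidef hU ha hb hν hν'

theorem trR_nonneg {n : ℕ} {A : Matrix (Fin n) (Fin n) ℂ} (hA : A.PosSemidef) : 0 ≤ trR A :=
  (Complex.le_def.1 hA.trace_nonneg).1

theorem trR_pos {n : ℕ} [NeZero n] {A : Matrix (Fin n) (Fin n) ℂ} (hA : A.PosDef) : 0 < trR A :=
  (Complex.lt_def.1 hA.trace_pos).1

theorem trR_smul_add_smul {n : ℕ} (A B : Matrix (Fin n) (Fin n) ℂ) (s t : ℝ) :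
    trR (s • A + t • B) = s * trR A + t * trR B := by
  simp [trR, trace_add, trace_smul]

end

theorem theorem3p4 {n : ℕ} (A B : Matrix (Fin n) (Fin n) ℂ) (hA : A.PosDef) (hB : B.PosDef)
    (ν : ℝ) (m : ℕ) (hm : 1 ≤ m) :
    (0 < ν → ν ≤ 1 / 2 →
      trR (CFC.abs (A ^ (1 - ν) * B ^ ν)) ^ m + ν ^ m * (trR A + trR B) ^ m
        - (2 * ν * (trR A * trR B) ^ (1 / 2 : ℝ)
            - rZero ν * ((trR A * trR B) ^ (1 / 4 : ℝ) - trR A ^ (1 / 2 : ℝ)) ^ 2) ^ m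
        ≤ trR ((1 - ν) • A + ν • B) ^ m) ∧
    (1 / 2 ≤ ν → ν ≤ 1 →
      trR (CFC.abs (A ^ (1 - ν) * B ^ ν)) ^ m + (1 - ν) ^ m * (trR A + trR B) ^ m
        - (2 * (1 - ν) * (trR A * trR B) ^ (1 / 2 : ℝ)
            - rZero ν * ((trR A * trR B) ^ (1 / 4 : ℝ) - trR B ^ (1 / 2 : ℝ)) ^ 2) ^ m
        ≤ trR ((1 - ν) • A + ν • B) ^ m) := by
  have hm' : m ≠ 0 := by omega
  -- The traces are positive only for n > 0; for n = 0 every term vanishes.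
  rcases Nat.eq_zero_or_pos n with rfl | hn
  · have h0 : ∀ M : Matrix (Fin 0) (Fin 0) ℂ, trR M = 0 := fun M => by simp [trR]
    simp [h0, hm']
  have : NeZero n := ⟨hn.ne'⟩
  have ha := trR_pos hA
  have hb := trR_pos hB
  have ht : 0 ≤ trR (CFC.abs (A ^ (1 - ν) * B ^ ν)) :=
    trR_nonneg (Matrix.nonneg_iff_posSemidef.1 (CFC.abs_nonneg _))
  rw [trR_smul_add_smul]
  constructor
  · intro h₀ h₁
    exact pow_refined_young ha hb h₀.le h₁ ht
      (trR_abs_rpow_mul_rpow_le hA hB ha hb h₀.le (by linarith)) hm'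
  · intro h₀ h₁
    have hHolder := trR_abs_rpow_mul_rpow_le hA hB ha hb (by linarith) h₁
    have hr : rZero (1 - ν) = rZero ν := by
      rw [rZero, rZero, sub_sub_cancel, min_comm (1 - ν)]
    -- Only the scalars trade places: the Hölder bound is symmetric under (a, ν) ↔ (b, 1 - ν), so
    -- the matrix product keeps its order.
    have h := pow_refined_young hb ha (ν := 1 - ν) (by linarith) (by linarith) ht
      (by rwa [sub_sub_cancel, mul_comm]) hm'
    rw [sub_sub_cancel, hr, mul_comm (trR B) (trR A), add_comm (trR B) (trR A),
      add_comm (ν * _)] at h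
    exact h
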